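/- Let $\mathcal S,\mathcal A$ be finite sets, $T:\mathcal S\times\mathcal A\to\Delta(\mathcal S)$ a transition function, $R:\mathcal S\times\mathcal A\to\mathbb R$ a reward function, $\gamma\in[0,1)$, $\varnothing\in\mathcal A$ a distinguished (no-op) action, $\lambda\ge 0$, and let $(R_i)_{i\in I}$ be a finite family of auxiliary reward functions $R_i:\mathcal S\times\mathcal A\to\mathbb R$. On a probability space with a filtration $(\mathcal F_n)_{n\ge0}$ let $(s_n,a_n,s_n')_{n\ge 0}$ be a sequence of experiences in the MDP: $s_n,a_n$ are $\mathcal F_n$-measurable, $s_n'$ is $\mathcal F_{n+1}$-measurable, and the conditional law of $s'_n$ given $\mathcal F_n$ is $T(s_n,a_n)$. (A single trajectory, $s_{n+1}=s_n'$, is a special case.) The behaviour policy is arbitrary, in particular it may be greedy in the limit, but almost surely every pair $(s,a)\in\mathcal S\times\mathcal A$ is visited infinitely often. Let $\alpha_n\ge 0$ be $\mathcal F_n$-measurable learning rates such that almost surely, for all $(s,a)$, $$\sum_{n:\,(s_n,a_n)=(s,a)}\alpha_n=\infty,\qquad \sum_{n:\,(s_n,a_n)=(s,a)}\alpha_n^2<\infty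 .$$ Start from arbitrary $\mathcal F_0$-measurable functions $Q_{i,0}$ ($i\in I$) and $Q_{\mathrm{AUP},0}$ on $\mathcal S\times\mathcal A$. For $j\in I\cup\{\mathrm{AUP}\}$ define $Q_{j,n+1}$ by $$Q_{j,n+1}(s_n,a_n)=Q_{j,n}(s_n,a_n)+\alpha_n\Big(\rho_{j,n}+\gamma\max_{a'}Q_{j,n}(s_n',a')-Q_{j,n}(s_n,a_n)\Big),$$ and $Q_{j,n+1}=Q_{j,n}$ at all other pairs, where $\rho_{i,n}=R_i(s_n,a_n)$ for $i\in I$ and $$\rho_{\mathrm{AUP},n}=R(s_n,a_n)-\lambda\,\frac{\mathrm{Penalty}_{n+\delta}(s_n,a_n)}{\mathrm{Scale}_{n+\delta}(s_n)},\qquad \mathrm{Penalty}_k(s,a)=\sum_{i\in I}\big|Q_{i,k}(s,a)-Q_{i,k}(s,\varnothing)\big| .$$ Here $\delta\in\{0,1\}$ is fixed and says whether the AUP reward is computed before ($\delta=0$) or after ($\delta=1$) the auxiliary updates of the same step. $\mathrm{Scale}_n(s)$ is any real-valued $\mathcal F_n$-measurable quantity, for example a measurable function of the current auxiliary Q-functions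 such as $\sum_{i\in I} Q_{i,n}(s,\varnothing)$. Assume that almost surely, for every $s$, $\mathrm{Scale}_n(s)$ converges as $n\to\infty$ to a limit $\mathrm{Scale}^*(s)>0$. (A quotient with denominator $0$, which can then occur only finitely often, is read as $0$.) Call $Q$ optimal for a reward function $r$ if $Q(s,a)=r(s,a)+\gamma\sum_{s'}T(s,a)(s')\max_{a'}Q(s',a')$ for all $(s,a)$. Then for every $i\in I$ there is a $Q_i^*$ that is optimal for $R_i$, such that almost surely $Q_{i,n}(s,a)\to Q_i^*(s,a)$ for all $i\in I$ and all $(s,a)$, and such that almost surely $Q_{\mathrm{AUP},n}(s,a)$ converges for all $(s,a)$, the limit being optimal for the reward function $$R^*_{\mathrm{AUP}}(s,a)=R(s,a)-\lambda\,\frac{\sum_{i\in I}|Q_i^*(s,a)-Q_i^*(s,\varnothing)|}{\mathrm{Scale}^*(s)} .$$ -/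

import Mathlib

open MeasureTheory ProbabilityTheory Filter Topology

noncomputable section

namespace AUP

/-- `Q` solves the Bellman optimality equation of the MDP with transition function `T`, reward `r`
and discount factor `γ` (for `γ ∈ [0,1)` its only solution is the optimal Q-function). -/
def IsOptimalQ {S A : Type*} [Fintype S] (T : S → A → PMF S) (γ : ℝ) (r Q : S → A → ℝ) : Prop :=
  ∀ s a, Q s a = r s a + γ * ∑ s', (T s a s').toReal * ⨆ a', Q s' a'

/-- The penalty of action `a` in state `s`, computed from the auxiliary Q-functions `Q`. -/
def penalty {S A ι : Type*} [Fintype ι] (noop : A) (Q : ι → S → A → ℝ) (s : S) (a : A) : ℝ :=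
  ∑ i, |Q i s a - Q i s noop|

/-- The reward `R - lam * Penalty / Scale`, computed from the auxiliary Q-functions `Q` and the
scale `sc`. -/
def aupReward {S A ι : Type*} [Fintype ι] (noop : A) (R : S → A → ℝ) (lam : ℝ)
    (Q : ι → S → A → ℝ) (sc : S → ℝ) (s : S) (a : A) : ℝ :=
  R s a - lam * (penalty noop Q s a / sc s)

open Classical in
/-- One tabular Q-learning update, with learning rate `α`, after taking action `a` in state `s`,
receiving the reward `r` and observing the next state `s'`. -/
def qUpdate {S A : Type*} (γ α r : ℝ) (s : S) (a : A) (s' : S) (Q : S → A → ℝ) : S → A → ℝ :=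
  fun x b => if x = s ∧ b = a then Q s a + α * (r + γ * (⨆ a', Q s' a') - Q s a) else Q x b

/-- The auxiliary Q-functions after `n` steps. At step `n` action `U n` is taken in state `X n`, the
next state `Y n` is observed, and every auxiliary Q-function is updated for its own reward. -/
def auxQ {Ω S A ι : Type*} (γ : ℝ) (r : ι → S → A → ℝ)
    (X : ℕ → Ω → S) (U : ℕ → Ω → A) (Y : ℕ → Ω → S) (α : ℕ → Ω → ℝ)
    (q₀ : Ω → ι → S → A → ℝ) : ℕ → Ω → ι → S → A → ℝ
  | 0 => q₀
  | n + 1 => fun ω i =>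
      qUpdate γ (α n ω) (r i (X n ω) (U n ω)) (X n ω) (U n ω) (Y n ω)
        (auxQ γ r X U Y α q₀ n ω i)

/-- The Q-function learned for the AUP reward, after `n` steps. The reward at step `n` is
computed from the auxiliary Q-functions and the scale in force at time `n + δ`: for `δ = 0` these
are the values before, for `δ = 1` the values after the auxiliary updates of that step. -/
def aupQ {Ω S A ι : Type*} [Fintype ι] (noop : A) (γ lam : ℝ) (R : S → A → ℝ)
    (r : ι → S → A → ℝ) (X : ℕ → Ω → S) (U : ℕ → Ω → A) (Y : ℕ → Ω → S) (α : ℕ → Ω → ℝ)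
    (q₀ : Ω → ι → S → A → ℝ) (Sc : ℕ → Ω → S → ℝ) (δ : ℕ) (p₀ : Ω → S → A → ℝ) :
    ℕ → Ω → S → A → ℝ
  | 0 => p₀
  | n + 1 => fun ω =>
      qUpdate γ (α n ω)
        (aupReward noop R lam (auxQ γ r X U Y α q₀ (n + δ) ω) (Sc (n + δ) ω) (X n ω) (U n ω))
        (X n ω) (U n ω) (Y n ω)
        (aupQ noop γ lam R r X U Y α q₀ Sc δ p₀ n ω)

/-- `(X n, U n, Y n)` is a sequence of experiences in an MDP with transition function `T`: given the
history `ℱ n`, which determines the state `X n` and the (arbitrarily chosen) action `U n`, the next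
state `Y n` has law `T (X n) (U n)`. A single trajectory is the case `X (n + 1) = Y n`; not
requiring this equation allows for episodes and resets. -/
structure IsExperience {Ω S A : Type*} {m : MeasurableSpace Ω} [MeasurableSpace S]
    [MeasurableSpace A] (μ : Measure Ω) (ℱ : Filtration ℕ m) (T : S → A → PMF S)
    (X : ℕ → Ω → S) (U : ℕ → Ω → A) (Y : ℕ → Ω → S) : Prop where
  measurable_state : ∀ n, Measurable[ℱ n] (X n)
  measurable_action : ∀ n, Measurable[ℱ n] (U n)
  measurable_next : ∀ n, Measurable[ℱ (n + 1)] (Y n)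
  law_next : ∀ n s', μ⟦Y n ⁻¹' {s'} | ℱ n⟧ =ᵐ[μ] fun ω => (T (X n ω) (U n ω) s').toReal

/-- Infinite exploration: almost surely every state-action pair is visited infinitely often. -/
def InfiniteExploration {Ω S A : Type*} {m : MeasurableSpace Ω} (μ : Measure Ω)
    (X : ℕ → Ω → S) (U : ℕ → Ω → A) : Prop :=
  ∀ᵐ ω ∂μ, ∀ s a, ∃ᶠ n in atTop, X n ω = s ∧ U n ω = a

/-- `α` is a learning rate schedule with infinite sum and finite sum of squares: the rates are
nonnegative, known when they are used, and almost surely, for every state-action pair, the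
rates used at the visits to that pair have infinite sum and finite sum of squares. -/
structure IsLearningRate {Ω S A : Type*} {m : MeasurableSpace Ω} (μ : Measure Ω)
    (ℱ : Filtration ℕ m) (X : ℕ → Ω → S) (U : ℕ → Ω → A) (α : ℕ → Ω → ℝ) : Prop where
  measurable : ∀ n, Measurable[ℱ n] (α n)
  nonneg : ∀ n ω, 0 ≤ α n ω
  sum_eq_top : ∀ᵐ ω ∂μ, ∀ s a, ¬ Summable ({n | X n ω = s ∧ U n ω = a}.indicator fun n => α n ω)
  summable_sq : ∀ᵐ ω ∂μ, ∀ s a,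
    Summable ({n | X n ω = s ∧ U n ω = a}.indicator fun n => α n ω ^ 2)

end AUP

end

/-! All Q-functions follow the same asynchronous scheme, so fix one sequence of experiences, a
reward function `r` and its optimal Q-function `Q*`, and subtract from `Q n - Q*` the error that
would arise if the next states were always assessed by `Q*`. That error is a weighted average of
bounded martingale differences, and the learning rates are square summable, so L² martingale
convergence makes it vanish almost surely. The remainder `D n` obeys an averaging scheme without
noise whose targets are bounded by `γ ‖D n‖ + o(1)`, so its limsup is at most `γ` times itself,
hence zero. The `o(1)` absorbs any deviation of the observed rewards from `r` that tends to zero.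

The almost sure event depends on the experiences and on the learning rates alone, not on the
rewards. It therefore serves all auxiliary rewards at once, then the AUP reward, which converges
because the auxiliary Q-functions do. -/

section Averaging

variable {E : Type*} [SeminormedAddCommGroup E] [NormedSpace ℝ E]

theorem norm_one_sub_smul_add_smul_le {t : ℝ} (ht : t ∈ Set.Icc 0 1) (p q : E) :
    ‖(1 - t) • p + t • q‖ ≤ (1 - t) * ‖p‖ + t * ‖q‖ :=
  (convexOn_norm convex_univ).2 trivial trivial (sub_nonneg.2 ht.2) ht.1 (sub_add_cancel 1 t)

theorem tendsto_prod_one_sub_atTop_zero {a : ℕ → ℝ} (ha : ∀ n, a n ∈ Set.Icc 0 1)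
    (hsum : ¬ Summable a) :
    Tendsto (fun n => ∏ k ∈ Finset.range n, (1 - a k)) atTop (𝓝 0) := by
  have hexp : Tendsto (fun n => Real.exp (-∑ k ∈ Finset.range n, a k)) atTop (𝓝 0) :=
    Real.tendsto_exp_neg_atTop_nhds_zero.comp
      ((not_summable_iff_tendsto_nat_atTop_of_nonneg fun n => (ha n).1).1 hsum)
  have hnonneg : ∀ k, 0 ≤ 1 - a k := fun k => sub_nonneg.2 (ha k).2
  refine squeeze_zero (fun n => Finset.prod_nonneg fun k _ => hnonneg k) (fun n => ?_) hexp
  rw [← Finset.sum_neg_distrib, Real.exp_sum]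
  exact Finset.prod_le_prod (fun k _ => hnonneg k) fun k _ => Real.one_sub_le_exp_neg (a k)

theorem tendsto_zero_of_succ_le_one_sub_mul {a v : ℕ → ℝ} (ha : ∀ᶠ n in atTop, a n ∈ Set.Icc 0 1)
    (hsum : ¬ Summable a) (hv₀ : ∀ n, 0 ≤ v n)
    (hv : ∀ᶠ n in atTop, v (n + 1) ≤ (1 - a n) * v n) : Tendsto v atTop (𝓝 0) := by
  obtain ⟨N, hN⟩ := eventually_atTop.1 (ha.and hv)
  have ha' : ∀ n, a (n + N) ∈ Set.Icc 0 1 := fun n => (hN _ (Nat.le_add_left N n)).1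
  have hle : ∀ n, v (n + N) ≤ (∏ k ∈ Finset.range n, (1 - a (k + N))) * v N := by
    intro n
    induction n with
    | zero => simp
    | succ n ih =>
      calc v (n + 1 + N) = v (n + N + 1) := by rw [Nat.add_right_comm]
        _ ≤ (1 - a (n + N)) * v (n + N) := (hN _ (Nat.le_add_left N n)).2
        _ ≤ (1 - a (n + N)) * ((∏ k ∈ Finset.range n, (1 - a (k + N))) * v N) :=
          mul_le_mul_of_nonneg_left ih (sub_nonneg.2 (ha' n).2)
        _ = (∏ k ∈ Finset.range (n + 1), (1 - a (k + N))) * v N := by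
          rw [Finset.prod_range_succ]; ring
  refine (tendsto_add_atTop_iff_nat N).1 (squeeze_zero (fun n => hv₀ _) hle ?_)
  simpa using (tendsto_prod_one_sub_atTop_zero ha'
    fun h => hsum ((summable_nat_add_iff N).1 h)).mul_const (v N)

theorem eventually_norm_le_add_of_averaging {a : ℕ → ℝ} {D y : ℕ → E} {c : ℝ}
    (ha : ∀ᶠ n in atTop, a n ∈ Set.Icc 0 1) (hsum : ¬ Summable a)
    (hD : ∀ n, D (n + 1) = (1 - a n) • D n + a n • y n) (hy : ∀ᶠ n in atTop, ‖y n‖ ≤ c)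
    {η : ℝ} (hη : 0 < η) : ∀ᶠ n in atTop, ‖D n‖ ≤ c + η := by
  have hexcess : Tendsto (fun n => max (‖D n‖ - c) 0) atTop (𝓝 0) := by
    refine tendsto_zero_of_succ_le_one_sub_mul ha hsum (fun n => le_max_right _ _) ?_
    filter_upwards [ha, hy] with n han hyn
    have h1a : 0 ≤ 1 - a n := sub_nonneg.2 han.2
    refine max_le ?_ (mul_nonneg h1a (le_max_right _ _))
    calc ‖D (n + 1)‖ - c ≤ (1 - a n) * ‖D n‖ + a n * ‖y n‖ - c := by
          rw [hD]; exact sub_le_sub_right (norm_one_sub_smul_add_smul_le han _ _) c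
      _ ≤ (1 - a n) * ‖D n‖ + a n * c - c := by gcongr; exact han.1
      _ = (1 - a n) * (‖D n‖ - c) := by ring
      _ ≤ (1 - a n) * max (‖D n‖ - c) 0 := mul_le_mul_of_nonneg_left (le_max_left _ _) h1a
  filter_upwards [hexcess.eventually_le_const hη] with n hn
  linarith [le_max_left (‖D n‖ - c) 0]

theorem tendsto_zero_of_averaging {a : ℕ → ℝ} {D y : ℕ → E}
    (ha : ∀ᶠ n in atTop, a n ∈ Set.Icc 0 1) (hsum : ¬ Summable a)
    (hD : ∀ n, D (n + 1) = (1 - a n) • D n + a n • y n) (hy : Tendsto y atTop (𝓝 0)) :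
    Tendsto D atTop (𝓝 0) := by
  rw [tendsto_zero_iff_norm_tendsto_zero, Metric.tendsto_nhds]
  intro ε hε
  have hsmall : ∀ᶠ n in atTop, ‖y n‖ ≤ ε / 3 :=
    (tendsto_zero_iff_norm_tendsto_zero.1 hy).eventually_le_const (by positivity)
  filter_upwards [eventually_norm_le_add_of_averaging ha hsum hD hsmall
    (by positivity : 0 < ε / 3)] with n hn
  rw [Real.dist_0_eq_abs, abs_norm]
  linarith

/-- The partial sums of `d`, of which a fraction `a n` leaks away at step `n`. They describe the
part of an averaging scheme with weights `a` that is due to the perturbations `d`. -/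
noncomputable def leakySum (a : ℕ → ℝ) (d : ℕ → E) : ℕ → E
  | 0 => 0
  | n + 1 => (1 - a n) • leakySum a d n + d n

-- `leakySum a d n + (l - ∑ k < n, d k)` averages the tails `l - ∑ k < n, d k`, which tend to `0`.
theorem tendsto_leakySum_zero {a : ℕ → ℝ} {d : ℕ → E} {l : E}
    (ha : ∀ᶠ n in atTop, a n ∈ Set.Icc 0 1) (hsum : ¬ Summable a)
    (hd : Tendsto (fun n => ∑ k ∈ Finset.range n, d k) atTop (𝓝 l)) :
    Tendsto (leakySum a d) atTop (𝓝 0) := by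
  have htail : Tendsto (fun n => l - ∑ k ∈ Finset.range n, d k) atTop (𝓝 0) := by
    simpa using (tendsto_const_nhds (x := l)).sub hd
  have haveraged : Tendsto (fun n => leakySum a d n + (l - ∑ k ∈ Finset.range n, d k)) atTop
      (𝓝 0) := by
    refine tendsto_zero_of_averaging ha hsum (fun n => ?_) htail
    rw [leakySum, Finset.sum_range_succ]
    module
  simpa using haveraged.sub htail

end Averaging

section Contraction

theorem tendsto_zero_of_eventually_le_mul_add {β : Type*} {l : Filter β} [l.NeBot] {u : β → ℝ}
    (hu : ∀ᶠ i in l, 0 ≤ u i) (hbdd : l.IsBoundedUnder (· ≤ ·) u) {γ : ℝ} (hγ : γ < 1)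
    (h : ∀ c, (∀ᶠ i in l, u i ≤ c) → ∀ η > 0, ∀ᶠ i in l, u i ≤ γ * c + η) :
    Tendsto u l (𝓝 0) := by
  have hcobdd : l.IsCoboundedUnder (· ≤ ·) u :=
    (isBoundedUnder_of_eventually_ge hu).isCoboundedUnder_le
  have hself : ∀ η > 0, limsup u l ≤ γ * (limsup u l + η) + η := fun η hη =>
    limsup_le_of_le hcobdd <| h _
      ((eventually_lt_of_limsup_lt (lt_add_of_pos_right _ hη) hbdd).mono fun _ => le_of_lt) η hη
  have hlimsup : limsup u l ≤ 0 := by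
    refine nonpos_of_mul_nonpos_right (a := 1 - γ) (le_of_forall_pos_le_add fun ε hε => ?_)
      (sub_pos.2 hγ)
    nlinarith [hself (ε / 2) (half_pos hε)]
  exact tendsto_order.2 ⟨fun b hb => hu.mono fun _ => hb.trans_le,
    fun b hb => eventually_lt_of_limsup_lt (hlimsup.trans_lt hb) hbdd⟩

variable {κ E : Type*} [Fintype κ] [SeminormedAddCommGroup E] [NormedSpace ℝ E]
  {a : ℕ → κ → ℝ} {D y : ℕ → κ → E} {γ : ℝ} {e : ℕ → ℝ}

theorem isBoundedUnder_norm_of_asynchronous_averaging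
    (ha : ∀ x, ∀ᶠ n in atTop, a n x ∈ Set.Icc 0 1)
    (hD : ∀ n x, D (n + 1) x = (1 - a n x) • D n x + a n x • y n x) (hγ₀ : 0 ≤ γ) (hγ₁ : γ < 1)
    (he : Tendsto e atTop (𝓝 0)) (hy : ∀ n x, ‖y n x‖ ≤ γ * ‖D n‖ + e n) :
    atTop.IsBoundedUnder (· ≤ ·) fun n => ‖D n‖ := by
  obtain ⟨N, hN⟩ := eventually_atTop.1 ((eventually_all.2 ha).and (he.eventually_le_const one_pos))
  set B : ℝ := max ‖D N‖ (1 / (1 - γ))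
  have hB₀ : 0 ≤ B := (norm_nonneg _).trans (le_max_left _ _)
  have hself : γ * B + 1 ≤ B := by
    have := (div_le_iff₀ (sub_pos.2 hγ₁)).1 (le_max_right ‖D N‖ (1 / (1 - γ)))
    linarith
  refine isBoundedUnder_of_eventually_le (a := B) (eventually_atTop.2 ⟨N, fun n hn => ?_⟩)
  induction n, hn using Nat.le_induction with
  | base => exact le_max_left _ _
  | succ n hn ih =>
    obtain ⟨han, hen⟩ := hN n hn
    refine (pi_norm_le_iff_of_nonneg hB₀).2 fun x => ?_
    have hyB : ‖y n x‖ ≤ B := by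
      linarith [hy n x, mul_le_mul_of_nonneg_left ih hγ₀]
    rw [hD]
    calc ‖(1 - a n x) • D n x + a n x • y n x‖ ≤ (1 - a n x) * ‖D n x‖ + a n x * ‖y n x‖ :=
          norm_one_sub_smul_add_smul_le (han x) _ _
      _ ≤ (1 - a n x) * B + a n x * B := by
          gcongr
          exacts [sub_nonneg.2 (han x).2, (norm_le_pi_norm _ x).trans ih, (han x).1]
      _ = B := by ring

theorem tendsto_zero_of_asynchronous_averaging
    (ha : ∀ x, ∀ᶠ n in atTop, a n x ∈ Set.Icc 0 1) (hsum : ∀ x, ¬ Summable (a · x))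
    (hD : ∀ n x, D (n + 1) x = (1 - a n x) • D n x + a n x • y n x) (hγ₀ : 0 ≤ γ) (hγ₁ : γ < 1)
    (he : Tendsto e atTop (𝓝 0)) (hy : ∀ n x, ‖y n x‖ ≤ γ * ‖D n‖ + e n) :
    Tendsto D atTop (𝓝 0) := by
  refine tendsto_zero_iff_norm_tendsto_zero.2 (tendsto_zero_of_eventually_le_mul_add
    (Eventually.of_forall fun n => norm_nonneg _)
    (isBoundedUnder_norm_of_asynchronous_averaging ha hD hγ₀ hγ₁ he hy) hγ₁ fun c hc η hη => ?_)
  have htarget : ∀ᶠ n in atTop, ∀ x, ‖y n x‖ ≤ γ * c + η / 2 := by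
    filter_upwards [hc, he.eventually_le_const (half_pos hη)] with n hcn hen x
    linarith [hy n x, mul_le_mul_of_nonneg_left hcn hγ₀]
  have hcoord : ∀ x, ∀ᶠ n in atTop, ‖D n x‖ ≤ γ * c + η := fun x => by
    filter_upwards [eventually_norm_le_add_of_averaging (D := (D · x)) (y := (y · x)) (ha x)
      (hsum x) (hD · x) (htarget.mono fun n h => h x) (half_pos hη)] with n hn
    linarith
  filter_upwards [eventually_all.2 hcoord, hc] with n hn hcn
  exact (pi_norm_le_iff_of_nonneg
    (add_nonneg (mul_nonneg hγ₀ ((norm_nonneg _).trans hcn)) hη.le)).2 hn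

end Contraction

section Martingale

variable {Ω : Type*} {m m₀ : MeasurableSpace Ω} {μ : Measure Ω}

theorem integral_mul_eq_zero_of_condExp_eq_zero {f g : Ω → ℝ} (hm : m ≤ m₀)
    [SigmaFinite (μ.trim hm)] (hf : StronglyMeasurable[m] f) (hfg : Integrable (f * g) μ)
    (hg : Integrable g μ) (hcond : μ[g | m] =ᵐ[μ] 0) : ∫ ω, f ω * g ω ∂μ = 0 := by
  have hzero : μ[f * g | m] =ᵐ[μ] 0 := by
    filter_upwards [condExp_mul_of_stronglyMeasurable_left hf hfg hg, hcond] with ω hω hω'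
    rw [hω, Pi.mul_apply, hω', Pi.zero_apply, mul_zero]
  calc ∫ ω, f ω * g ω ∂μ = ∫ ω, (μ[f * g | m]) ω ∂μ := (integral_condExp hm).symm
    _ = 0 := by rw [integral_congr_ae hzero]; simp

variable {ℱ : Filtration ℕ m₀}

theorem stronglyMeasurable_sum_range {E : Type*} [TopologicalSpace E] [AddCommMonoid E]
    [ContinuousAdd E] {d : ℕ → Ω → E} (hd : ∀ n, StronglyMeasurable[ℱ (n + 1)] (d n)) (n : ℕ) :
    StronglyMeasurable[ℱ n] fun ω => ∑ k ∈ Finset.range n, d k ω :=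
  Finset.stronglyMeasurable_fun_sum _ fun k hk =>
    (hd k).mono (ℱ.mono (Finset.mem_range.1 hk))

variable [IsFiniteMeasure μ]

theorem martingale_sum_range {E : Type*} [NormedAddCommGroup E] [NormedSpace ℝ E] [CompleteSpace E]
    {d : ℕ → Ω → E} (hd : ∀ n, StronglyMeasurable[ℱ (n + 1)] (d n))
    (hint : ∀ n, Integrable (d n) μ) (hcond : ∀ n, μ[d n | ℱ n] =ᵐ[μ] 0) :
    Martingale (fun n ω => ∑ k ∈ Finset.range n, d k ω) ℱ μ := by
  refine martingale_of_condExp_sub_eq_zero_nat (stronglyMeasurable_sum_range hd)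
    (fun n => integrable_finsetSum _ fun k _ => hint k) fun n => ?_
  convert hcond n using 2
  funext ω
  simp [Finset.sum_range_succ]

variable {d : ℕ → Ω → ℝ}

theorem integral_sum_range_sq (hd : ∀ n, StronglyMeasurable[ℱ (n + 1)] (d n))
    (hL2 : ∀ n, MemLp (d n) 2 μ) (hcond : ∀ n, μ[d n | ℱ n] =ᵐ[μ] 0) (n : ℕ) :
    ∫ ω, (∑ k ∈ Finset.range n, d k ω) ^ 2 ∂μ = ∑ k ∈ Finset.range n, ∫ ω, d k ω ^ 2 ∂μ := by
  induction n with
  | zero => simp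
  | succ n ih =>
    set M : Ω → ℝ := fun ω => ∑ k ∈ Finset.range n, d k ω
    have hM2 : MemLp M 2 μ := memLp_finsetSum _ fun k _ => hL2 k
    have hMd : Integrable (fun ω => M ω * d n ω) μ := hM2.integrable_mul (hL2 n)
    have horth : ∫ ω, M ω * d n ω ∂μ = 0 :=
      integral_mul_eq_zero_of_condExp_eq_zero (ℱ.le n) (stronglyMeasurable_sum_range hd n) hMd
        ((hL2 n).integrable one_le_two) (hcond n)
    calc ∫ ω, (∑ k ∈ Finset.range (n + 1), d k ω) ^ 2 ∂μ
        = ∫ ω, (M ω ^ 2 + 2 * (M ω * d n ω)) + d n ω ^ 2 ∂μ := by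
          congr 1 with ω
          rw [Finset.sum_range_succ]
          ring
      _ = ∫ ω, M ω ^ 2 ∂μ + 2 * ∫ ω, M ω * d n ω ∂μ + ∫ ω, d n ω ^ 2 ∂μ := by
          rw [← integral_const_mul, ← integral_add hM2.integrable_sq (hMd.const_mul 2)]
          exact integral_add (hM2.integrable_sq.add (hMd.const_mul 2)) (hL2 n).integrable_sq
      _ = ∑ k ∈ Finset.range (n + 1), ∫ ω, d k ω ^ 2 ∂μ := by
          rw [horth, ih, Finset.sum_range_succ]
          ring

theorem eLpNorm_one_le_of_integral_sq_le {f : Ω → ℝ} {K : ℝ} (hf : MemLp f 2 μ)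
    (hK : ∫ ω, f ω ^ 2 ∂μ ≤ K) : eLpNorm f 1 μ ≤ ENNReal.ofReal (μ.real Set.univ + K) := by
  rw [eLpNorm_one_eq_lintegral_enorm,
    ← ofReal_integral_norm_eq_lintegral_enorm (hf.integrable one_le_two)]
  refine ENNReal.ofReal_le_ofReal ?_
  calc ∫ ω, ‖f ω‖ ∂μ ≤ ∫ ω, 1 + f ω ^ 2 ∂μ := by
        refine integral_mono (hf.integrable one_le_two).norm
          ((integrable_const 1).add hf.integrable_sq) fun ω => ?_
        rw [Real.norm_eq_abs]
        dsimp only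
        rw [← sq_abs]
        nlinarith [sq_nonneg (|f ω| - 1), abs_nonneg (f ω)]
    _ = μ.real Set.univ + ∫ ω, f ω ^ 2 ∂μ := by
        rw [integral_add (integrable_const 1) hf.integrable_sq]
        simp
    _ ≤ μ.real Set.univ + K := by gcongr

theorem ae_exists_tendsto_sum_of_summable_integral_sq
    (hd : ∀ n, StronglyMeasurable[ℱ (n + 1)] (d n)) (hL2 : ∀ n, MemLp (d n) 2 μ)
    (hcond : ∀ n, μ[d n | ℱ n] =ᵐ[μ] 0) (hsum : Summable fun n => ∫ ω, d n ω ^ 2 ∂μ) :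
    ∀ᵐ ω ∂μ, ∃ l, Tendsto (fun n => ∑ k ∈ Finset.range n, d k ω) atTop (𝓝 l) := by
  have hmart := martingale_sum_range hd (fun n => (hL2 n).integrable one_le_two) hcond
  refine hmart.submartingale.exists_ae_tendsto_of_bdd fun n =>
    eLpNorm_one_le_of_integral_sq_le (K := ∑' n, ∫ ω, d n ω ^ 2 ∂μ)
      (memLp_finsetSum _ fun k _ => hL2 k) ?_
  rw [integral_sum_range_sq hd hL2 hcond]
  exact hsum.sum_le_tsum _ fun k _ => integral_nonneg fun ω => sq_nonneg _

variable {ξ β : ℕ → Ω → ℝ} {C : ℝ}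

theorem ae_exists_tendsto_sum_mul_of_sum_sq_le
    (hξm : ∀ n, Measurable[ℱ (n + 1)] (ξ n)) (hξ : ∀ n ω, |ξ n ω| ≤ C)
    (hξc : ∀ n, μ[ξ n | ℱ n] =ᵐ[μ] 0) (hβm : ∀ n, Measurable[ℱ n] (β n)) {K : ℝ}
    (hβ : ∀ n ω, ∑ k ∈ Finset.range n, β k ω ^ 2 ≤ K) :
    ∀ᵐ ω ∂μ, ∃ l, Tendsto (fun n => ∑ k ∈ Finset.range n, β k ω * ξ k ω) atTop (𝓝 l) := by
  have hβsq : ∀ n ω, β n ω ^ 2 ≤ K := fun n ω =>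
    (Finset.single_le_sum (f := fun k => β k ω ^ 2) (fun k _ => sq_nonneg _)
      (Finset.self_mem_range_succ n)).trans (hβ (n + 1) ω)
  have hβ2 : ∀ n, MemLp (β n) 2 μ := fun n =>
    MemLp.of_bound ((hβm n).mono (ℱ.le n) le_rfl).aestronglyMeasurable (√K)
      (Eventually.of_forall fun ω => Real.abs_le_sqrt (hβsq n ω))
  have hξtop : ∀ n, MemLp (ξ n) ⊤ μ := fun n =>
    memLp_top_of_bound ((hξm n).mono (ℱ.le _) le_rfl).aestronglyMeasurable C
      (Eventually.of_forall (hξ n))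
  have hL2 : ∀ n, MemLp (β n * ξ n) 2 μ := fun n => (hξtop n).mul (hβ2 n)
  refine ae_exists_tendsto_sum_of_summable_integral_sq (d := fun n => β n * ξ n) (ℱ := ℱ)
    (fun n => (((hβm n).mono (ℱ.mono n.le_succ) le_rfl).mul (hξm n)).stronglyMeasurable)
    hL2 (fun n => ?_) ?_
  · filter_upwards [condExp_mul_of_stronglyMeasurable_left (hβm n).stronglyMeasurable
      ((hL2 n).integrable one_le_two) ((hξtop n).integrable le_top), hξc n] with ω hω hω'
    rw [hω, Pi.mul_apply, hω', Pi.zero_apply, mul_zero]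
  · refine summable_of_sum_range_le (c := ∫ _, C ^ 2 * K ∂μ)
      (fun n => integral_nonneg fun ω => sq_nonneg _) fun n => ?_
    rw [← integral_finsetSum _ fun k _ => (hL2 k).integrable_sq]
    refine integral_mono (integrable_finsetSum _ fun k _ => (hL2 k).integrable_sq)
      (integrable_const _) fun ω => ?_
    calc ∑ k ∈ Finset.range n, (β k * ξ k) ω ^ 2
        ≤ ∑ k ∈ Finset.range n, C ^ 2 * β k ω ^ 2 := Finset.sum_le_sum fun k _ => by
          rw [Pi.mul_apply, mul_pow, mul_comm]
          exact mul_le_mul_of_nonneg_right (sq_le_sq' (abs_le.1 (hξ k ω)).1 (abs_le.1 (hξ k ω)).2)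
            (sq_nonneg _)
      _ ≤ C ^ 2 * K := by
          rw [← Finset.mul_sum]
          exact mul_le_mul_of_nonneg_left (hβ n ω) (sq_nonneg C)

open Classical in
/-- The process `β`, replaced by `0` from the time at which its sum of squares exceeds `K`. -/
noncomputable def truncateSumSq (K : ℝ) (β : ℕ → Ω → ℝ) (n : ℕ) (ω : Ω) : ℝ :=
  if ∑ k ∈ Finset.range (n + 1), β k ω ^ 2 ≤ K then β n ω else 0

theorem measurable_truncateSumSq (hβm : ∀ n, Measurable[ℱ n] (β n)) (K : ℝ) (n : ℕ) :
    Measurable[ℱ n] (truncateSumSq K β n) := by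
  have hsum : Measurable[ℱ n] fun ω => ∑ k ∈ Finset.range (n + 1), β k ω ^ 2 :=
    Finset.measurable_sum _ fun k hk =>
      ((hβm k).mono (ℱ.mono (Nat.lt_succ_iff.1 (Finset.mem_range.1 hk))) le_rfl).pow_const 2
  exact Measurable.ite (hsum measurableSet_Iic) (hβm n) measurable_const

theorem sum_truncateSumSq_sq_le {K : ℝ} (hK : 0 ≤ K) (β : ℕ → Ω → ℝ) (n : ℕ) (ω : Ω) :
    ∑ k ∈ Finset.range n, truncateSumSq K β k ω ^ 2 ≤ K := by
  induction n with
  | zero => simpa using hK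
  | succ n ih =>
    by_cases h : ∑ k ∈ Finset.range (n + 1), β k ω ^ 2 ≤ K
    · refine (Finset.sum_le_sum fun k _ => ?_).trans h
      rw [truncateSumSq]
      split_ifs
      exacts [le_rfl, by simpa using sq_nonneg (β k ω)]
    · rw [Finset.sum_range_succ]
      simpa [truncateSumSq, if_neg h] using ih

theorem truncateSumSq_eq_self {K : ℝ} {ω : Ω} (hβ : Summable fun n => β n ω ^ 2)
    (hK : ∑' n, β n ω ^ 2 ≤ K) (n : ℕ) : truncateSumSq K β n ω = β n ω :=
  if_pos ((hβ.sum_le_tsum _ fun _ _ => sq_nonneg _).trans hK)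

theorem ae_exists_tendsto_sum_mul_of_summable_sq
    (hξm : ∀ n, Measurable[ℱ (n + 1)] (ξ n)) (hξ : ∀ n ω, |ξ n ω| ≤ C)
    (hξc : ∀ n, μ[ξ n | ℱ n] =ᵐ[μ] 0) (hβm : ∀ n, Measurable[ℱ n] (β n))
    (hβ : ∀ᵐ ω ∂μ, Summable fun n => β n ω ^ 2) :
    ∀ᵐ ω ∂μ, ∃ l, Tendsto (fun n => ∑ k ∈ Finset.range n, β k ω * ξ k ω) atTop (𝓝 l) := by
  have htrunc := ae_all_iff.2 fun K : ℕ => ae_exists_tendsto_sum_mul_of_sum_sq_le hξm hξ hξc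
    (measurable_truncateSumSq hβm K) (sum_truncateSumSq_sq_le K.cast_nonneg β)
  filter_upwards [hβ, htrunc] with ω hsummable hω
  obtain ⟨K, hK⟩ := exists_nat_ge (∑' n, β n ω ^ 2)
  simpa only [truncateSumSq_eq_self hsummable hK] using hω K

end Martingale

namespace AUP

section Bellman

theorem abs_iSup_sub_iSup_le_norm_sub {A : Type*} [Fintype A] (f g : A → ℝ) :
    |(⨆ a, f a) - ⨆ a, g a| ≤ ‖f - g‖ := by
  rcases isEmpty_or_nonempty A with hA | hA
  · simp [Real.iSup_of_isEmpty]
  have hle : ∀ f g : A → ℝ, ⨆ a, f a ≤ (⨆ a, g a) + ‖f - g‖ := fun f g => ciSup_le fun a => by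
    linarith [(le_abs_self _).trans (norm_le_pi_norm (f - g) a), Pi.sub_apply f g a,
      le_ciSup (Set.finite_range g).bddAbove a]
  exact abs_sub_le_iff.2 ⟨sub_le_iff_le_add'.2 (hle f g),
    sub_le_iff_le_add'.2 (norm_sub_rev f g ▸ hle g f)⟩

variable {S A : Type*}

theorem toReal_pmf_le_one (p : PMF S) (s : S) : (p s).toReal ≤ 1 :=
  ENNReal.toReal_le_of_le_ofReal zero_le_one (by simpa using p.coe_le_one s)

variable [Fintype S]

theorem sum_toReal_pmf (p : PMF S) : ∑ s, (p s).toReal = 1 := by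
  rw [← ENNReal.toReal_sum fun s _ => p.apply_ne_top s, ← tsum_fintype (L := .unconditional S),
    p.tsum_coe, ENNReal.toReal_one]

theorem abs_sum_toReal_pmf_mul_sub_le (p : PMF S) {f g : S → ℝ} {c : ℝ}
    (h : ∀ s, |f s - g s| ≤ c) :
    |∑ s, (p s).toReal * f s - ∑ s, (p s).toReal * g s| ≤ c :=
  calc |∑ s, (p s).toReal * f s - ∑ s, (p s).toReal * g s|
      = |∑ s, (p s).toReal * (f s - g s)| := by simp only [mul_sub, Finset.sum_sub_distrib]
    _ ≤ ∑ s, |(p s).toReal * (f s - g s)| := Finset.abs_sum_le_sum_abs _ _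
    _ ≤ ∑ s, (p s).toReal * c := Finset.sum_le_sum fun s _ => by
        rw [abs_mul, abs_of_nonneg ENNReal.toReal_nonneg]
        exact mul_le_mul_of_nonneg_left (h s) ENNReal.toReal_nonneg
    _ = c := by rw [← Finset.sum_mul, sum_toReal_pmf, one_mul]

/-- The Bellman optimality operator of the MDP with transition function `T`, reward `r` and
discount factor `γ`, whose fixed points are the solutions of the Bellman optimality equation. -/
noncomputable def bellman (T : S → A → PMF S) (γ : ℝ) (r Q : S → A → ℝ) : S → A → ℝ :=
  fun s a => r s a + γ * ∑ s', (T s a s').toReal * ⨆ a', Q s' a'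

theorem norm_bellman_sub_le [Fintype A] (T : S → A → PMF S) (γ : ℝ) (r Q Q' : S → A → ℝ) :
    ‖bellman T γ r Q - bellman T γ r Q'‖ ≤ |γ| * ‖Q - Q'‖ := by
  have hc : 0 ≤ |γ| * ‖Q - Q'‖ := by positivity
  refine (pi_norm_le_iff_of_nonneg hc).2 fun s => (pi_norm_le_iff_of_nonneg hc).2 fun a => ?_
  simp only [Pi.sub_apply, bellman, add_sub_add_left_eq_sub, ← mul_sub, Real.norm_eq_abs, abs_mul]
  exact mul_le_mul_of_nonneg_left (abs_sum_toReal_pmf_mul_sub_le _ fun s' =>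
    (abs_iSup_sub_iSup_le_norm_sub _ _).trans (norm_le_pi_norm (Q - Q') s')) (abs_nonneg γ)

theorem exists_isOptimalQ [Finite A] (T : S → A → PMF S) {γ : ℝ} (hγ : |γ| < 1)
    (r : S → A → ℝ) : ∃ Q, IsOptimalQ T γ r Q := by
  cases nonempty_fintype A
  have hcontr : ContractingWith ‖γ‖₊ (bellman T γ r) :=
    ⟨hγ, LipschitzWith.of_dist_le_mul fun Q Q' => by
      simpa only [dist_eq_norm, coe_nnnorm, Real.norm_eq_abs] using norm_bellman_sub_le T γ r Q Q'⟩
  exact ⟨_, fun s a => (congrFun₂ hcontr.fixedPoint_isFixedPt s a).symm⟩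

end Bellman

section Path

variable {S A : Type*} {T : S → A → PMF S} {γ : ℝ} {x y : ℕ → S} {u : ℕ → A} {α : ℕ → ℝ}

/-- The learning rate effective at the pair `(s, a)`: `α n` if `(s, a)` is visited at step `n`, and
`0` otherwise. -/
noncomputable def visitRate (x : ℕ → S) (u : ℕ → A) (α : ℕ → ℝ) (s : S) (a : A) : ℕ → ℝ :=
  {n | x n = s ∧ u n = a}.indicator α

/-- The deviation of the indicator of `y n = s'` from its conditional probability. -/
noncomputable def transitionNoise (T : S → A → PMF S) (x : ℕ → S) (u : ℕ → A) (y : ℕ → S) (s' : S)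
    (n : ℕ) : ℝ :=
  {n | y n = s'}.indicator 1 n - (T (x n) (u n) s').toReal

/-- The pathwise conditions under which Q-learning converges along the experiences
`(x n, u n, y n)`: the learning rates effective at each pair are eventually in `[0, 1]` and have
infinite sum, and the transition noise they pick up is summable, if only conditionally. -/
structure IsRegularPath (T : S → A → PMF S) (x : ℕ → S) (u : ℕ → A) (y : ℕ → S) (α : ℕ → ℝ) :
    Prop where
  eventually_visitRate_mem : ∀ s a, ∀ᶠ n in atTop, visitRate x u α s a n ∈ Set.Icc 0 1
  not_summable_visitRate : ∀ s a, ¬ Summable (visitRate x u α s a)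
  exists_tendsto_sum_noise : ∀ s a s', ∃ l, Tendsto (fun n => ∑ k ∈ Finset.range n,
    visitRate x u α s a k * transitionNoise T x u y s' k) atTop (𝓝 l)

theorem qUpdate_eq_add_visitRate_mul (ρ : ℝ) (Q : S → A → ℝ) (n : ℕ) (s : S) (a : A) :
    qUpdate γ (α n) ρ (x n) (u n) (y n) Q s a =
      Q s a + visitRate x u α s a n * (ρ + γ * (⨆ a', Q (y n) a') - Q s a) := by
  by_cases h : x n = s ∧ u n = a
  · obtain ⟨rfl, rfl⟩ := h
    simp [qUpdate, visitRate]
  · have h' : ¬ (s = x n ∧ a = u n) := fun ⟨hs, ha⟩ => h ⟨hs.symm, ha.symm⟩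
    simp [qUpdate, visitRate, h, h']

theorem sum_transitionNoise_mul [Fintype S] (V : S → ℝ) (n : ℕ) :
    ∑ s', transitionNoise T x u y s' n * V s' =
      V (y n) - ∑ s', (T (x n) (u n) s').toReal * V s' := by
  classical
  simp [transitionNoise, sub_mul, Set.indicator_apply]

theorem IsRegularPath.exists_tendsto_sum_noise_mul [Fintype S] (h : IsRegularPath T x u y α)
    (V : S → ℝ) (s : S) (a : A) : ∃ l, Tendsto (fun n => ∑ k ∈ Finset.range n,
      visitRate x u α s a k * (γ * ∑ s', transitionNoise T x u y s' k * V s')) atTop (𝓝 l) := by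
  choose l hl using h.exists_tendsto_sum_noise s a
  refine ⟨_, ((tendsto_finsetSum Finset.univ fun s' _ =>
    (hl s').mul_const (V s')).const_mul γ).congr fun n => ?_⟩
  simp only [Finset.sum_mul, Finset.mul_sum]
  rw [Finset.sum_comm]
  exact Finset.sum_congr rfl fun _ _ => Finset.sum_congr rfl fun _ _ => by ring

/-- The part of the error of Q-learning at the pair `(s, a)` that is due to the transition noise, if
the value of the next state is assessed by `Q`. -/
noncomputable def noiseError [Fintype S] (T : S → A → PMF S) (γ : ℝ) (x : ℕ → S) (u : ℕ → A)
    (y : ℕ → S) (α : ℕ → ℝ) (Q : S → A → ℝ) (s : S) (a : A) : ℕ → ℝ :=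
  leakySum (visitRate x u α s a) fun n =>
    visitRate x u α s a n * (γ * ∑ s', transitionNoise T x u y s' n * ⨆ a', Q s' a')

theorem IsRegularPath.tendsto_noiseError_zero [Fintype S] (h : IsRegularPath T x u y α)
    (Q : S → A → ℝ) (s : S) (a : A) :
    Tendsto (noiseError T γ x u y α Q s a) atTop (𝓝 0) :=
  have ⟨_, hl⟩ := h.exists_tendsto_sum_noise_mul (fun s' => ⨆ a', Q s' a') s a
  tendsto_leakySum_zero (h.eventually_visitRate_mem s a) (h.not_summable_visitRate s a) hl

-- On a visit, the noise turns the expected value of the next state in the Bellman equation for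
-- `Qlim` into the value of the next state observed, which is what the update of `Q` uses.
theorem qUpdate_sub_sub_noiseError_succ [Fintype S] {r Q Qlim : S → A → ℝ}
    (hopt : IsOptimalQ T γ r Qlim) (ρ : ℝ) (n : ℕ) (s : S) (a : A) :
    qUpdate γ (α n) ρ (x n) (u n) (y n) Q s a - Qlim s a
        - noiseError T γ x u y α Qlim s a (n + 1) =
      (1 - visitRate x u α s a n) • (Q s a - Qlim s a - noiseError T γ x u y α Qlim s a n)
        + visitRate x u α s a n • (ρ - r (x n) (u n)
          + γ * ((⨆ a', Q (y n) a') - ⨆ a', Qlim (y n) a')) := by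
  rw [qUpdate_eq_add_visitRate_mul, noiseError, leakySum, sum_transitionNoise_mul]
  by_cases h : x n = s ∧ u n = a
  · obtain ⟨rfl, rfl⟩ := h
    simp only [smul_eq_mul]
    linear_combination (-visitRate x u α (x n) (u n) n) * hopt (x n) (u n)
  · have hzero : visitRate x u α s a n = 0 :=
      Set.indicator_of_notMem (s := {n | x n = s ∧ u n = a}) h α
    simp [hzero]

theorem IsRegularPath.tendsto_of_qUpdate [Fintype S] [Finite A] (h : IsRegularPath T x u y α)
    (hγ : |γ| < 1) {Q : ℕ → S → A → ℝ} {ρ : ℕ → ℝ} {r Qlim : S → A → ℝ}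
    (hQ : ∀ n, Q (n + 1) = qUpdate γ (α n) (ρ n) (x n) (u n) (y n) (Q n))
    (hopt : IsOptimalQ T γ r Qlim) (hρ : Tendsto (fun n => ρ n - r (x n) (u n)) atTop (𝓝 0))
    (s : S) (a : A) : Tendsto (fun n => Q n s a) atTop (𝓝 (Qlim s a)) := by
  cases nonempty_fintype A
  set w : ℕ → S × A → ℝ := fun n z => noiseError T γ x u y α Qlim z.1 z.2 n
  have hw : Tendsto w atTop (𝓝 0) :=
    tendsto_pi_nhds.2 fun z => h.tendsto_noiseError_zero Qlim z.1 z.2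
  set D : ℕ → S × A → ℝ := fun n z => Q n z.1 z.2 - Qlim z.1 z.2 - w n z with hD
  have hvalue : ∀ n s', |(⨆ a', Q n s' a') - ⨆ a', Qlim s' a'| ≤ ‖D n‖ + ‖w n‖ := fun n s' => by
    refine (abs_iSup_sub_iSup_le_norm_sub _ _).trans
      ((pi_norm_le_iff_of_nonneg (by positivity)).2 fun a' => ?_)
    calc ‖Q n s' a' - Qlim s' a'‖ = ‖D n (s', a') + w n (s', a')‖ := by rw [hD, sub_add_cancel]
      _ ≤ ‖D n‖ + ‖w n‖ := norm_add_le_of_le (norm_le_pi_norm _ _) (norm_le_pi_norm _ _)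
  have herror : Tendsto (fun n => |ρ n - r (x n) (u n)| + |γ| * ‖w n‖) atTop (𝓝 0) := by
    simpa using hρ.abs.add (hw.norm.const_mul |γ|)
  have hcontract : Tendsto D atTop (𝓝 0) :=
    tendsto_zero_of_asynchronous_averaging (fun z => h.eventually_visitRate_mem z.1 z.2)
      (fun z => h.not_summable_visitRate z.1 z.2)
      (fun n z => by
        simp only [hD, hQ]
        exact qUpdate_sub_sub_noiseError_succ hopt (ρ n) n z.1 z.2)
      (abs_nonneg γ) hγ herror fun n _ => by
        grw [norm_add_le, norm_mul, Real.norm_eq_abs, Real.norm_eq_abs, Real.norm_eq_abs,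
          hvalue n (y n)]
        exact le_of_eq (by ring)
  have hlim := (tendsto_pi_nhds.1 (hcontract.add hw) (s, a)).add_const (Qlim s a)
  simpa [hD] using hlim

end Path

section Experience

variable {Ω S A : Type*} {m : MeasurableSpace Ω} {μ : Measure Ω} {ℱ : Filtration ℕ m}
  {T : S → A → PMF S} {X : ℕ → Ω → S} {U : ℕ → Ω → A} {Y : ℕ → Ω → S} {α : ℕ → Ω → ℝ}

theorem abs_transitionNoise_le_one (x y : ℕ → S) (u : ℕ → A) (s' : S) (n : ℕ) :
    |transitionNoise T x u y s' n| ≤ 1 := by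
  classical
  rw [transitionNoise, Set.indicator_apply]
  refine abs_sub_le_of_nonneg_of_le ?_ ?_ ENNReal.toReal_nonneg (toReal_pmf_le_one _ _) <;>
    split_ifs <;> simp

theorem IsLearningRate.ae_summable_visitRate_sq (hα : IsLearningRate μ ℱ X U α) (s : S) (a : A) :
    ∀ᵐ ω ∂μ, Summable fun n => visitRate (X · ω) (U · ω) (α · ω) s a n ^ 2 := by
  classical
  filter_upwards [hα.summable_sq] with ω hω
  refine (hω s a).congr fun n => ?_
  simp only [visitRate, Set.indicator_apply]
  split_ifs <;> simp

theorem IsLearningRate.visitRate_nonneg (hα : IsLearningRate μ ℱ X U α) (ω : Ω) (s : S) (a : A)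
    (n : ℕ) : 0 ≤ visitRate (X · ω) (U · ω) (α · ω) s a n :=
  Set.indicator_nonneg (fun n _ => hα.nonneg n ω) n

theorem IsLearningRate.ae_eventually_visitRate_mem (hα : IsLearningRate μ ℱ X U α) (s : S) (a : A) :
    ∀ᵐ ω ∂μ, ∀ᶠ n in atTop, visitRate (X · ω) (U · ω) (α · ω) s a n ∈ Set.Icc 0 1 := by
  filter_upwards [hα.ae_summable_visitRate_sq s a] with ω hω
  filter_upwards [hω.tendsto_atTop_zero.eventually_le_const one_pos] with n hn
  exact ⟨hα.visitRate_nonneg ω s a n,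
    (sq_le_one_iff₀ (hα.visitRate_nonneg ω s a n)).1 hn⟩

variable [MeasurableSpace S] [MeasurableSpace A] [MeasurableSingletonClass S]

theorem measurable_visitRate [MeasurableSingletonClass A] (hexp : IsExperience μ ℱ T X U Y)
    (hα : IsLearningRate μ ℱ X U α) (s : S) (a : A) (n : ℕ) :
    Measurable[ℱ n] fun ω => visitRate (X · ω) (U · ω) (α · ω) s a n := by
  classical
  simp only [visitRate, Set.indicator_apply]
  exact Measurable.ite ((hexp.measurable_state n (MeasurableSet.singleton s)).inter
    (hexp.measurable_action n (MeasurableSet.singleton a))) (hα.measurable n) measurable_const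

theorem measurable_toReal_transition [Countable S] [Countable A] [MeasurableSingletonClass A]
    (hexp : IsExperience μ ℱ T X U Y) (s' : S) (n : ℕ) :
    Measurable[ℱ n] fun ω => (T (X n ω) (U n ω) s').toReal :=
  (Measurable.of_discrete (f := fun z : S × A => (T z.1 z.2 s').toReal)).comp
    ((hexp.measurable_state n).prodMk (hexp.measurable_action n))

theorem measurable_transitionNoise [Countable S] [Countable A] [MeasurableSingletonClass A]
    (hexp : IsExperience μ ℱ T X U Y) (s' : S) (n : ℕ) :
    Measurable[ℱ (n + 1)] fun ω => transitionNoise T (X · ω) (U · ω) (Y · ω) s' n := by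
  classical
  simp only [transitionNoise, Set.indicator_apply]
  exact (Measurable.ite (hexp.measurable_next n (MeasurableSet.singleton s')) measurable_const
    measurable_const).sub ((measurable_toReal_transition hexp s' n).mono (ℱ.mono n.le_succ) le_rfl)

theorem condExp_transitionNoise [Countable S] [Countable A] [MeasurableSingletonClass A]
    [IsFiniteMeasure μ] (hexp : IsExperience μ ℱ T X U Y) (s' : S) (n : ℕ) :
    μ[fun ω => transitionNoise T (X · ω) (U · ω) (Y · ω) s' n | ℱ n] =ᵐ[μ] 0 := by
  set p : Ω → ℝ := fun ω => (T (X n ω) (U n ω) s').toReal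
  have hp : Measurable[ℱ n] p := measurable_toReal_transition hexp s' n
  have hpint : Integrable p μ :=
    Integrable.of_bound (hp.mono (ℱ.le n) le_rfl).aestronglyMeasurable 1 <|
      Eventually.of_forall fun ω => by
        rw [Real.norm_of_nonneg ENNReal.toReal_nonneg]
        exact toReal_pmf_le_one _ _
  have hY : MeasurableSet (Y n ⁻¹' {s'}) :=
    ((hexp.measurable_next n).mono (ℱ.le _) le_rfl) (MeasurableSet.singleton s')
  have hnoise : (fun ω => transitionNoise T (X · ω) (U · ω) (Y · ω) s' n) =
      (Y n ⁻¹' {s'}).indicator (fun _ => (1 : ℝ)) - p := by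
    classical
    funext ω
    simp [p, transitionNoise, Set.indicator_apply]
  rw [hnoise]
  filter_upwards [condExp_sub ((integrable_const (1 : ℝ)).indicator hY) hpint (ℱ n),
    hexp.law_next n s'] with ω hsub hlaw
  rw [hsub, Pi.sub_apply, hlaw, condExp_of_stronglyMeasurable (ℱ.le n) hp.stronglyMeasurable hpint,
    sub_self, Pi.zero_apply]

theorem ae_isRegularPath [Countable S] [Countable A] [MeasurableSingletonClass A]
    [IsFiniteMeasure μ] (hexp : IsExperience μ ℱ T X U Y) (hα : IsLearningRate μ ℱ X U α) :
    ∀ᵐ ω ∂μ, IsRegularPath T (X · ω) (U · ω) (Y · ω) (α · ω) := by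
  have hnoise : ∀ᵐ ω ∂μ, ∀ s a s', ∃ l, Tendsto (fun n => ∑ k ∈ Finset.range n,
      visitRate (X · ω) (U · ω) (α · ω) s a k * transitionNoise T (X · ω) (U · ω) (Y · ω) s' k)
      atTop (𝓝 l) := by
    simp only [ae_all_iff]
    exact fun s a s' => ae_exists_tendsto_sum_mul_of_summable_sq
      (measurable_transitionNoise hexp s') (fun n ω => abs_transitionNoise_le_one _ _ _ s' n)
      (condExp_transitionNoise hexp s') (measurable_visitRate hexp hα s a)
      (hα.ae_summable_visitRate_sq s a)
  filter_upwards [hnoise, hα.sum_eq_top,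
    ae_all_iff.2 fun s => ae_all_iff.2 (hα.ae_eventually_visitRate_mem s)] with ω hω hsum hmem
  exact ⟨hmem, hsum, hω⟩

end Experience

section Reward

variable {S A ι β : Type*} {l : Filter β}

theorem tendsto_aupReward [Fintype ι] (noop : A) (R : S → A → ℝ) (lam : ℝ)
    {Q : β → ι → S → A → ℝ} {Qlim : ι → S → A → ℝ} {sc : β → S → ℝ} {sclim : S → ℝ}
    (hQ : ∀ i s a, Tendsto (fun n => Q n i s a) l (𝓝 (Qlim i s a)))
    (hsc : ∀ s, Tendsto (fun n => sc n s) l (𝓝 (sclim s))) (h₀ : ∀ s, sclim s ≠ 0) (s : S) (a : A) :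
    Tendsto (fun n => aupReward noop R lam (Q n) (sc n) s a) l
      (𝓝 (aupReward noop R lam Qlim sclim s a)) :=
  tendsto_const_nhds.sub (Tendsto.const_mul lam (Tendsto.div
    (tendsto_finsetSum _ fun i _ => ((hQ i s a).sub (hQ i s noop)).abs) (hsc s) (h₀ s)))

theorem tendsto_apply_sub_apply_zero [Finite S] [Finite A] {f : β → S → A → ℝ} {g : S → A → ℝ}
    (h : ∀ s a, Tendsto (fun n => f n s a) l (𝓝 (g s a))) (x : β → S) (u : β → A) :
    Tendsto (fun n => f n (x n) (u n) - g (x n) (u n)) l (𝓝 0) := by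
  rw [Metric.tendsto_nhds]
  intro ε hε
  filter_upwards [eventually_all.2 fun s => eventually_all.2 fun a =>
    Metric.tendsto_nhds.1 (h s a) ε hε] with n hn
  simpa only [Real.dist_eq, sub_zero] using hn (x n) (u n)

end Reward

end AUP

theorem theorem1_general {Ω S A ι : Type*} [Fintype S] [Finite A] [Fintype ι]
    [MeasurableSpace S] [MeasurableSingletonClass S]
    [MeasurableSpace A] [MeasurableSingletonClass A]
    {m : MeasurableSpace Ω} (μ : Measure Ω) [IsFiniteMeasure μ] (ℱ : Filtration ℕ m)
    (T : S → A → PMF S) (R : S → A → ℝ) (γ : ℝ) (hγ : |γ| < 1) (noop : A)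
    (lam : ℝ) (r : ι → S → A → ℝ)
    (X : ℕ → Ω → S) (U : ℕ → Ω → A) (Y : ℕ → Ω → S) (hexp : AUP.IsExperience μ ℱ T X U Y)
    (α : ℕ → Ω → ℝ) (hα : AUP.IsLearningRate μ ℱ X U α)
    (q₀ : Ω → ι → S → A → ℝ) (p₀ : Ω → S → A → ℝ) (Sc : ℕ → Ω → S → ℝ) (Sclim : Ω → S → ℝ)
    (hSclim : ∀ᵐ ω ∂μ, ∀ s, Sclim ω s ≠ 0 ∧ Tendsto (fun n => Sc n ω s) atTop (𝓝 (Sclim ω s)))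
    (δ : ℕ) :
    ∃ Qaux : ι → S → A → ℝ, (∀ i, AUP.IsOptimalQ T γ (r i) (Qaux i)) ∧
      ∀ᵐ ω ∂μ,
        (∀ i s a, Tendsto (fun n => AUP.auxQ γ r X U Y α q₀ n ω i s a) atTop
          (𝓝 (Qaux i s a))) ∧
        ∃ Qaup : S → A → ℝ,
          AUP.IsOptimalQ T γ (AUP.aupReward noop R lam Qaux (Sclim ω)) Qaup ∧
          ∀ s a, Tendsto
            (fun n => AUP.aupQ noop γ lam R r X U Y α q₀ Sc δ p₀ n ω s a) atTop
            (𝓝 (Qaup s a)) := by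
  choose Qaux hQaux using fun i => AUP.exists_isOptimalQ T hγ (r i)
  refine ⟨Qaux, hQaux, ?_⟩
  filter_upwards [AUP.ae_isRegularPath hexp hα, hSclim] with ω hpath hscale
  have haux : ∀ i s a, Tendsto (fun n => AUP.auxQ γ r X U Y α q₀ n ω i s a) atTop
      (𝓝 (Qaux i s a)) := fun i =>
    hpath.tendsto_of_qUpdate hγ (fun _ => rfl) (hQaux i) <| by
      simp only [sub_self, tendsto_const_nhds]
  obtain ⟨Qaup, hQaup⟩ := AUP.exists_isOptimalQ T hγ (AUP.aupReward noop R lam Qaux (Sclim ω))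
  have hreward := AUP.tendsto_aupReward noop R lam haux (fun s => (hscale s).2)
    fun s => (hscale s).1
  exact ⟨haux, Qaup, hQaup, hpath.tendsto_of_qUpdate hγ (fun _ => rfl) hQaup
    (AUP.tendsto_apply_sub_apply_zero (fun s a => (tendsto_add_atTop_iff_nat δ).2 (hreward s a))
      (X · ω) (U · ω))⟩

theorem theorem1 {Ω S A ι : Type*} [Fintype S] [Fintype A] [Fintype ι]
    [MeasurableSpace S] [DiscreteMeasurableSpace S]
    [MeasurableSpace A] [DiscreteMeasurableSpace A]
    {m : MeasurableSpace Ω} (μ : Measure Ω) [IsProbabilityMeasure μ] (ℱ : Filtration ℕ m)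
    -- the MDP with its no-op action, and the auxiliary rewards
    (T : S → A → PMF S) (R : S → A → ℝ) (γ : ℝ) (hγ₀ : 0 ≤ γ) (hγ₁ : γ < 1) (noop : A)
    (lam : ℝ) (hlam : 0 ≤ lam) (r : ι → S → A → ℝ)
    -- the experiences and the learning rates
    (X : ℕ → Ω → S) (U : ℕ → Ω → A) (Y : ℕ → Ω → S) (hexp : AUP.IsExperience μ ℱ T X U Y)
    (hvisit : AUP.InfiniteExploration μ X U)
    (α : ℕ → Ω → ℝ) (hα : AUP.IsLearningRate μ ℱ X U α)
    -- the initial values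
    (q₀ : Ω → ι → S → A → ℝ) (hq₀ : ∀ i s a, Measurable[ℱ 0] fun ω => q₀ ω i s a)
    (p₀ : Ω → S → A → ℝ) (hp₀ : ∀ s a, Measurable[ℱ 0] fun ω => p₀ ω s a)
    -- the scale, which is computed online and converges to a positive limit
    (Sc : ℕ → Ω → S → ℝ) (hSc : ∀ n s, Measurable[ℱ n] fun ω => Sc n ω s)
    (Sclim : Ω → S → ℝ)
    (hSclim : ∀ᵐ ω ∂μ, ∀ s, 0 < Sclim ω s ∧ Tendsto (fun n => Sc n ω s) atTop (𝓝 (Sclim ω s)))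
    -- whether the reward is computed before or after the auxiliary updates of the step
    (δ : ℕ) (hδ : δ ≤ 1) :
    ∃ Qaux : ι → S → A → ℝ, (∀ i, AUP.IsOptimalQ T γ (r i) (Qaux i)) ∧
      ∀ᵐ ω ∂μ,
        (∀ i s a, Tendsto (fun n => AUP.auxQ γ r X U Y α q₀ n ω i s a) atTop
          (𝓝 (Qaux i s a))) ∧
        ∃ Qaup : S → A → ℝ,
          AUP.IsOptimalQ T γ (AUP.aupReward noop R lam Qaux (Sclim ω)) Qaup ∧
          ∀ s a, Tendsto
            (fun n => AUP.aupQ noop γ lam R r X U Y α q₀ Sc δ p₀ n ω s a) atTop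
            (𝓝 (Qaup s a)) :=
  theorem1_general μ ℱ T R γ (abs_lt.2 ⟨neg_one_lt_zero.trans_le hγ₀, hγ₁⟩) noop lam r X U Y hexp
    α hα q₀ p₀ Sc Sclim (hSclim.mono fun _ h s => ⟨(h s).1.ne', (h s).2⟩) δ
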